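/- Consider a Bell scenario with $n$ parties, where party $i$ chooses one of $m_i$ measurements and measurement $j$ of party $i$ has $v_{ij}$ possible outcomes (all these numbers finite). Correlations are vectors $p=(p_{k_1\ldots k_n|j_1\ldots j_n})\in\mathbb{R}^t$, $t=\prod_i\sum_j v_{ij}$. For an assignment $\lambda=(\lambda_{ij})$ of one outcome to each measurement of each party, let $p^\lambda_{k_1\ldots k_n|j_1\ldots j_n}=1$ if $\lambda_{ij_i}=k_i$ for all $i$, and $0$ otherwise. The Bell polytope $\mathcal{B}=\mathcal{B}(n,m,v)$ is the convex hull of all the $p^\lambda$. For a party $i$, a measurement $j$ of party $i$ and an outcome $k$ of it, let $p(i,j,k)$ be the restriction of the vector $p$ to the components with $j_i=j$ and $k_i=k$. An inequality $b\cdot p\ge b_0$ supports a facet of a polytope $P$ if it holds for all $p\in P$ and $\{p\in P: b\cdot p=b_0\}$ is nonempty, different from $P$, and of dimension $\dim P-1$. It is genuinely $n$-partite if there are no $i,j,k$ and no coefficient vector $c$ such that $b\cdot p-b_0=c\cdot p(i,j,k)$ for all $p\in\mathcal{B}$, i.e. if it cannot be rewritten on $\mathcal{B}$ in the form $c\cdot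 p(i,j,k)\ge 0$. Let $b\cdot p\ge b_0$ be a genuinely $n$-partite inequality that supports a facet of $\mathcal{B}$. Let $j'$ be a measurement of a party $i'$, let $k^*$ be one of its outcomes, and let $\mathcal{B}^{v+1}$ be the Bell polytope of the scenario obtained by allowing one extra outcome $k'$ for the measurement $j'$ of party $i'$. Then the inequality $$b\cdot p+b(i',j',k^*)\cdot p(i',j',k')\ \ge\ b_0$$ supports a facet of $\mathcal{B}^{v+1}$, where $p$ ranges over $\mathcal{B}^{v+1}$ and in the term $b\cdot p$ only the components of $p$ that do not involve the new outcome $k'$ appear. -/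

import Mathlib

open scoped Matrix

/-! A Bell scenario is given by a finite type `ι` of parties, for each party `i` a finite type `J i`
of measurements, and for each measurement `j` of party `i` a finite type `K i j` of outcomes
(so `n = |ι|`, `m i = |J i|`, `v i j = |K i j|`). -/

/-- The index set of the probabilities `p_{k₁ … kₙ | j₁ … jₙ}`: a measurement and an outcome of that
measurement for every party. -/
abbrev BellIndex {ι : Type*} {J : ι → Type*} (K : ∀ i, J i → Type*) : Type _ :=
  ∀ i, Σ j : J i, K i j

/-- The index set of the components in which the indices of party `i` are kept fixed: a measurement
and an outcome for every party other than `i`. -/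
abbrev BellOthers {ι : Type*} {J : ι → Type*} (K : ∀ i, J i → Type*) (i : ι) : Type _ :=
  ∀ l : {l : ι // l ≠ i}, Σ j : J l, K l j

/-- `p(i, j, k)`: the restriction of `p` to the components for which party `i` performs the
measurement `j` and obtains the outcome `k`. -/
def bellRestrict {ι : Type*} [DecidableEq ι] {J : ι → Type*} {K : ∀ i, J i → Type*}
    (p : BellIndex K → ℝ) (i : ι) (j : J i) (k : K i j) : BellOthers K i → ℝ :=
  fun x => p ((Equiv.piSplitAt i fun l => Σ j : J l, K l j).symm (⟨j, k⟩, x))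

open Classical in
/-- The deterministic vector `p^a` of an assignment `a` of an outcome to every measurement of every
party. -/
noncomputable def bellDet {ι : Type*} {J : ι → Type*} {K : ∀ i, J i → Type*}
    (a : ∀ i, ∀ j : J i, K i j) : BellIndex K → ℝ :=
  fun x => if ∀ i, a i (x i).1 = (x i).2 then 1 else 0

/-- The Bell polytope: the convex hull of the deterministic vectors. -/
def bellPolytope {ι : Type*} {J : ι → Type*} (K : ∀ i, J i → Type*) : Set (BellIndex K → ℝ) :=
  convexHull ℝ (Set.range (bellDet (K := K)))

/-- The dimension of (the affine hull of) a nonempty set. -/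
noncomputable def affDim {V : Type*} [AddCommGroup V] [Module ℝ V] (S : Set V) : ℕ :=
  Module.finrank ℝ (affineSpan ℝ S).direction

/-- The inequality `f p ≥ c` is valid for `P` and supports a facet of `P`: the face
`{p ∈ P | f p = c}` is proper (neither empty nor all of `P`) and has dimension `dim P - 1`. -/
def SupportsFacet {V : Type*} [AddCommGroup V] [Module ℝ V] (P : Set V) (f : V → ℝ) (c : ℝ) :
    Prop :=
  (∀ p ∈ P, f p ≥ c) ∧
    {p ∈ P | f p = c}.Nonempty ∧ {p ∈ P | f p = c} ≠ P ∧
    affDim {p ∈ P | f p = c} + 1 = affDim P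

/-- The inequality `b · p ≥ b₀` is genuinely `n`-partite: it cannot be rewritten, using the
equalities satisfied by all points of the Bell polytope (and a positive rescaling, which can be
absorbed into `c`), in the form `c · p(i, j, k) ≥ 0`, which involves only the probabilities
associated with one measurement `j` and one outcome `k` of one party `i`. -/
def GenuinelyPartite {ι : Type*} [Fintype ι] [DecidableEq ι] {J : ι → Type*} [∀ i, Fintype (J i)]
    {K : ∀ i, J i → Type*} [∀ i j, Fintype (K i j)] (b : BellIndex K → ℝ) (b₀ : ℝ) : Prop :=
  ¬ ∃ (i : ι) (j : J i) (k : K i j) (c : BellOthers K i → ℝ),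
    ∀ p ∈ bellPolytope K, b ⬝ᵥ p - b₀ = c ⬝ᵥ bellRestrict p i j k

/-- The outcomes after one extra outcome has been added to the measurement `j'` of party `i'`:
the second summand has exactly one element if `(i, j) = (i', j')`, and is empty otherwise. -/
abbrev AddOutcome {ι : Type*} {J : ι → Type*} (K : ∀ i, J i → Type*) (i' : ι) (j' : J i') :
    ∀ i, J i → Type _ :=
  fun i j => K i j ⊕ PLift ((⟨i, j⟩ : Σ i, J i) = ⟨i', j'⟩)

/-- The extra outcome `k'` of the measurement `j'` of party `i'`. -/
def extraOutcome {ι : Type*} {J : ι → Type*} (K : ∀ i, J i → Type*) (i' : ι) (j' : J i') :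
    AddOutcome K i' j' i' j' :=
  Sum.inr ⟨rfl⟩

/-- The measurement-outcome pairs of a party, viewed in the enlarged scenario. -/
def keepOutcome {ι : Type*} {J : ι → Type*} {K : ∀ i, J i → Type*} (i' : ι) (j' : J i') {i : ι}
    (x : Σ j : J i, K i j) : Σ j : J i, AddOutcome K i' j' i j :=
  ⟨x.1, Sum.inl x.2⟩

/-- The left-hand side `b · p + b(i', j', k⋆) · p(i', j', k')` of the lifted inequality, for `p` in
the space of the enlarged scenario. In `b · p` only the components of `p` that already exist in the
original scenario appear. The components of `p(i', j', k')` are indexed by measurements and outcomes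
of the parties other than `i'`, and these are the same in both scenarios. -/
def liftedLHS {ι : Type*} [Fintype ι] [DecidableEq ι] {J : ι → Type*} [∀ i, Fintype (J i)]
    {K : ∀ i, J i → Type*} [∀ i j, Fintype (K i j)] (i' : ι) (j' : J i') (kstar : K i' j')
    (b : BellIndex K → ℝ) (p : BellIndex (AddOutcome K i' j') → ℝ) : ℝ :=
  (b ⬝ᵥ fun x => p fun i => keepOutcome i' j' (x i)) +
    bellRestrict b i' j' kstar ⬝ᵥ
      fun x => bellRestrict p i' j' (extraOutcome K i' j') fun l => keepOutcome i' j' (x l)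

/-! Merging `k'` into `k⋆` is a linear map `π` (`mergeMap`) of the enlarged polytope onto the
original one, and the lifted left-hand side is `b ⬝ᵥ π p`. The lifted face is therefore the preimage
of the given facet. By rank-nullity it has codimension one as soon as every direction of the
enlarged polytope killed by `π` is also a direction of the lifted face
(`SupportsFacet.comp_of_image`).

Such directions are spanned by the differences of two vertices that agree except for using `k'` or
`k⋆`. Each difference is a linear function (`moveMap`) of the restriction `p^a(i', j', k⋆)`. If
`p^a` lies on the facet, both vertices lie on the lifted face. For the other `a`, suppose the
difference is not a direction of the lifted face. A separating functional then yields a functional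
of `p(i', j', k⋆)` that vanishes on the facet but not at `p^a`. By `SupportsFacet.exists_eq_mul` it
is a nonzero multiple of `b ⬝ᵥ p - b₀` on the polytope, so the inequality would not be genuinely
`n`-partite. -/

/-! ### Facets, linear maps and functionals -/

theorem affDim_eq_finrank_vectorSpan {V : Type*} [AddCommGroup V] [Module ℝ V] (S : Set V) :
    affDim S = Module.finrank ℝ (vectorSpan ℝ S) := by
  rw [affDim, direction_affineSpan]

/-- A facet of `π '' P'` pulls back along a linear map `π` to a facet of `P'` as soon as the face
contains all the directions of `P'` that `π` collapses. -/
theorem SupportsFacet.comp_of_image {V V' : Type*} [AddCommGroup V] [Module ℝ V] [AddCommGroup V']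
    [Module ℝ V'] [FiniteDimensional ℝ V'] {P : Set V} {P' : Set V'} {f : V → ℝ} {c : ℝ}
    (h : SupportsFacet P f c) (π : V' →ₗ[ℝ] V) (hπ : π '' P' = P)
    (hker : ∀ v ∈ vectorSpan ℝ P', π v = 0 → v ∈ vectorSpan ℝ {p ∈ P' | f (π p) = c}) :
    SupportsFacet P' (fun p => f (π p)) c := by
  obtain ⟨hval, hne, hproper, hdim⟩ := h
  have hF : π '' {p ∈ P' | f (π p) = c} = {p ∈ P | f p = c} := by
    subst hπ
    ext q
    constructor
    · rintro ⟨p, ⟨hp, hpc⟩, rfl⟩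
      exact ⟨⟨p, hp, rfl⟩, hpc⟩
    · rintro ⟨⟨p, hp, rfl⟩, hpc⟩
      exact ⟨p, ⟨hp, hpc⟩, rfl⟩
  refine ⟨fun p hp => hval _ (hπ ▸ Set.mem_image_of_mem π hp), ?_, ?_, ?_⟩
  · rw [← hF] at hne
    exact hne.of_image
  · intro heq
    apply hproper
    rw [← hF, heq, hπ]
  · have hrank : ∀ D : Submodule ℝ V', Module.finrank ℝ (D.map π) +
        Module.finrank ℝ (LinearMap.ker π ⊓ D : Submodule ℝ V') = Module.finrank ℝ D := by
      intro D
      have h1 := LinearMap.finrank_range_add_finrank_ker (π.domRestrict D)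
      rw [LinearMap.range_domRestrict, LinearMap.ker_domRestrict] at h1
      rw [← h1, ← Submodule.finrank_map_subtype_eq D ((LinearMap.ker π).comap D.subtype),
        Submodule.map_comap_subtype, inf_comm]
    have hmap : ∀ S : Set V', (vectorSpan ℝ S).map π = vectorSpan ℝ (π '' S) := fun S => by
      simpa using AffineMap.map_vectorSpan (s := S) π.toAffineMap
    -- Face and polytope lose the same dimension under `π`, so the codimension is unchanged.
    have hinf : LinearMap.ker π ⊓ vectorSpan ℝ {p ∈ P' | f (π p) = c} =
        LinearMap.ker π ⊓ vectorSpan ℝ P' :=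
      le_antisymm (inf_le_inf_left _ (vectorSpan_mono ℝ fun p hp => hp.1))
        fun v hv => ⟨hv.1, hker v hv.2 hv.1⟩
    simp only [affDim_eq_finrank_vectorSpan] at hdim ⊢
    have h1 := hrank (vectorSpan ℝ P')
    have h2 := hrank (vectorSpan ℝ {p ∈ P' | f (π p) = c})
    rw [hmap, hπ] at h1
    rw [hmap, hF, hinf] at h2
    omega

/-- A linear functional that vanishes on a facet is a multiple of the functional defining it. -/
theorem SupportsFacet.exists_eq_mul {V : Type*} [AddCommGroup V] [Module ℝ V]
    [FiniteDimensional ℝ V] {P : Set V} {f : V →ₗ[ℝ] ℝ} {c : ℝ} (h : SupportsFacet P f c)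
    (g : V →ₗ[ℝ] ℝ) (hg : ∀ p ∈ P, f p = c → g p = 0) :
    ∃ μ : ℝ, ∀ p ∈ P, g p = μ * (f p - c) := by
  obtain ⟨-, ⟨p₀, hp₀, hp₀c⟩, hproper, hdim⟩ := h
  obtain ⟨p₁, hp₁, hp₁c⟩ : ∃ p ∈ P, f p ≠ c := by
    by_contra! hall
    exact hproper (Set.ext fun p => ⟨fun hp => hp.1, fun hp => ⟨hp, hall p hp⟩⟩)
  simp only [affDim_eq_finrank_vectorSpan] at hdim
  set F := {p ∈ P | f p = c}
  have hfg : vectorSpan ℝ F ≤ LinearMap.ker f ⊓ LinearMap.ker g := by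
    rw [vectorSpan_def, Submodule.span_le]
    rintro _ ⟨p, hp, q, hq, rfl⟩
    simp [hp.2, hq.2, hg p hp.1 hp.2, hg q hq.1 hq.2]
  have hfv : f (p₁ - p₀) ≠ 0 := by
    rw [map_sub, hp₀c]
    exact sub_ne_zero.2 hp₁c
  -- Codimension one: a single direction leaving the facet completes its directions to those of `P`.
  have hsup : vectorSpan ℝ F ⊔ Submodule.span ℝ {p₁ - p₀} = vectorSpan ℝ P := by
    have hle : vectorSpan ℝ F ⊔ Submodule.span ℝ {p₁ - p₀} ≤ vectorSpan ℝ P := by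
      refine sup_le (vectorSpan_mono ℝ fun p hp => hp.1) ?_
      rw [Submodule.span_singleton_le_iff_mem]
      exact vsub_mem_vectorSpan ℝ hp₁ hp₀
    refine Submodule.eq_of_le_of_finrank_le hle ?_
    rw [← hdim, Nat.succ_le_iff]
    refine Submodule.finrank_lt_finrank_of_lt (lt_of_le_of_ne le_sup_left fun heq => hfv ?_)
    have hmem : p₁ - p₀ ∈ vectorSpan ℝ F := by
      rw [heq]
      exact Submodule.mem_sup_right (Submodule.mem_span_singleton_self _)
    exact (hfg hmem).1
  refine ⟨g (p₁ - p₀) / f (p₁ - p₀), fun p hp => ?_⟩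
  have hmem : p - p₀ ∈ vectorSpan ℝ F ⊔ Submodule.span ℝ {p₁ - p₀} := by
    rw [hsup]
    exact vsub_mem_vectorSpan ℝ hp hp₀
  obtain ⟨d, hd, w, hw, hdw⟩ := Submodule.mem_sup.1 hmem
  obtain ⟨t, rfl⟩ := Submodule.mem_span_singleton.1 hw
  have hfd : f d = 0 := (hfg hd).1
  have hgd : g d = 0 := (hfg hd).2
  have h1 : f p - c = t * f (p₁ - p₀) := by
    rw [← hp₀c, ← map_sub, ← hdw, map_add, hfd, map_smul, zero_add, smul_eq_mul]
  have h2 : g p = t * g (p₁ - p₀) := by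
    have h3 : g p = g (p - p₀) := by rw [map_sub, hg p₀ hp₀ hp₀c, sub_zero]
    rw [h3, ← hdw, map_add, hgd, map_smul, zero_add, smul_eq_mul]
  rw [h1, h2]
  field_simp

/-- A linear functional that vanishes on the generators lying on a face of a convex hull vanishes
on the whole face. -/
theorem eq_zero_of_mem_convexHull_face {V : Type*} [AddCommGroup V] [Module ℝ V] {S : Set V}
    {f g : V →ₗ[ℝ] ℝ} {c : ℝ} (hf : ∀ p ∈ S, c ≤ f p) (hg : ∀ p ∈ S, f p = c → g p = 0)
    {p : V} (hp : p ∈ convexHull ℝ S) (hpc : f p = c) : g p = 0 := by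
  -- The bound `c ≤ f p` must be carried along: it forces both ends of a segment onto the face when
  -- an interior point is on it.
  have hconv : Convex ℝ {p : V | c ≤ f p ∧ (f p = c → g p = 0)} := by
    rw [convex_iff_forall_pos]
    rintro x ⟨hx, hx'⟩ y ⟨hy, hy'⟩ s t hs ht hst
    simp only [Set.mem_ofPred_eq, map_add, map_smul, smul_eq_mul]
    have hc : s * c + t * c = c := by rw [← add_mul, hst, one_mul]
    have hsx := mul_le_mul_of_nonneg_left hx hs.le
    have hty := mul_le_mul_of_nonneg_left hy ht.le
    refine ⟨by linarith, fun heq => ?_⟩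
    have h1 : f x = c := mul_left_cancel₀ hs.ne' (by linarith)
    have h2 : f y = c := mul_left_cancel₀ ht.ne' (by linarith)
    rw [hx' h1, hy' h2, mul_zero, mul_zero, add_zero]
  have hsub : S ⊆ {p : V | c ≤ f p ∧ (f p = c → g p = 0)} := fun q hq => ⟨hf q hq, hg q hq⟩
  exact (convexHull_min hsub hconv hp).2 hpc

/-! ### Assignments and vertices with an extra outcome -/

section Outcome

variable {ι : Type*} {J : ι → Type*} {K : ∀ i, J i → Type*}

/-- The outcome of the original scenario obtained by merging the extra outcome into `kstar`. -/
def mergeOutcome {i' : ι} {j' : J i'} (kstar : K i' j') {i : ι} {j : J i} :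
    AddOutcome K i' j' i j → K i j
  | Sum.inl k => k
  | Sum.inr h => Eq.rec (motive := fun (s : Σ i, J i) _ => K s.1 s.2) kstar h.down.symm

/-- The index obtained by merging the extra outcome into `kstar`. -/
def mergeIndex {i' : ι} {j' : J i'} (kstar : K i' j') (y : BellIndex (AddOutcome K i' j')) :
    BellIndex K :=
  fun i => ⟨(y i).1, mergeOutcome kstar (y i).2⟩

/-- An assignment of the original scenario, viewed in the enlarged one. -/
def keepAssignment (i' : ι) (j' : J i') (a : ∀ i, ∀ j : J i, K i j) :
    ∀ i, ∀ j : J i, AddOutcome K i' j' i j :=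
  fun i j => Sum.inl (a i j)

open Classical in
/-- The assignment of the enlarged scenario in which the outcome of `j'` is replaced by the extra
one. -/
noncomputable def extraAssignment (i' : ι) (j' : J i') (a : ∀ i, ∀ j : J i, K i j) :
    ∀ i, ∀ j : J i, AddOutcome K i' j' i j :=
  fun i j => if h : (⟨i, j⟩ : Σ i, J i) = ⟨i', j'⟩ then Sum.inr ⟨h⟩ else Sum.inl (a i j)

theorem extraAssignment_self (i' : ι) (j' : J i') (a : ∀ i, ∀ j : J i, K i j) :
    extraAssignment i' j' a i' j' = extraOutcome K i' j' := by
  simp [extraAssignment, extraOutcome]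

theorem extraAssignment_of_ne {i' : ι} {j' : J i'} (a : ∀ i, ∀ j : J i, K i j) {i : ι} {j : J i}
    (h : (⟨i, j⟩ : Σ i, J i) ≠ ⟨i', j'⟩) : extraAssignment i' j' a i j = Sum.inl (a i j) := by
  simp [extraAssignment, h]

/-- An assignment of the enlarged scenario either does not use the extra outcome, or is obtained
from an assignment with outcome `kstar` by replacing it with the extra outcome. -/
theorem exists_eq_keepAssignment_or_extraAssignment {i' : ι} {j' : J i'} (kstar : K i' j')
    (a' : ∀ i, ∀ j : J i, AddOutcome K i' j' i j) :
    ∃ a : ∀ i, ∀ j : J i, K i j, a' = keepAssignment i' j' a ∨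
      a i' j' = kstar ∧ a' = extraAssignment i' j' a := by
  refine ⟨fun i j => mergeOutcome kstar (a' i j), ?_⟩
  have hne : ∀ i (j : J i), (⟨i, j⟩ : Σ i, J i) ≠ ⟨i', j'⟩ →
      a' i j = Sum.inl (mergeOutcome kstar (a' i j)) := by
    intro i j h
    rcases a' i j with k | hk
    · rfl
    · exact absurd hk.down h
  rcases hk : a' i' j' with k | e
  · left
    funext i j
    by_cases h : (⟨i, j⟩ : Σ i, J i) = ⟨i', j'⟩
    · cases h
      simp [keepAssignment, hk, mergeOutcome]
    · exact hne i j h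
  · right
    refine ⟨by simp only [hk]; rfl, ?_⟩
    funext i j
    by_cases h : (⟨i, j⟩ : Σ i, J i) = ⟨i', j'⟩
    · cases h
      rw [extraAssignment_self, hk]
      rfl
    · rw [extraAssignment_of_ne _ h]
      exact hne i j h

theorem bellDet_keepAssignment_keepOutcome (i' : ι) (j' : J i') (a : ∀ i, ∀ j : J i, K i j)
    (x : BellIndex K) :
    bellDet (keepAssignment i' j' a) (fun i => keepOutcome i' j' (x i)) = bellDet a x := by
  unfold bellDet
  congr 1
  exact propext (forall_congr' fun i => Sum.inl_injective.eq_iff)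

variable {i' : ι} {j' : J i'}

theorem bellDet_keepAssignment_of_ne (kstar : K i' j') (a : ∀ i, ∀ j : J i, K i j)
    {y : BellIndex (AddOutcome K i' j')} (hy : y i' ≠ ⟨j', extraOutcome K i' j'⟩) :
    bellDet (keepAssignment i' j' a) y = bellDet a (mergeIndex kstar y) := by
  unfold bellDet
  congr 1
  refine propext (forall_congr' fun i => ?_)
  simp only [mergeIndex, keepAssignment]
  rcases h : y i with ⟨j, k | e⟩
  · simp [mergeOutcome]
  · cases e.down
    exact absurd h hy

theorem bellDet_extraAssignment_keep {a : ∀ i, ∀ j : J i, K i j} {y : BellIndex (AddOutcome K i' j')}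
    {k : K i' j'} (hy : y i' = ⟨j', Sum.inl k⟩) : bellDet (extraAssignment i' j' a) y = 0 := by
  refine if_neg fun hall => ?_
  have h := hall i'
  rw [hy] at h
  simp only [extraAssignment_self] at h
  cases h

theorem bellDet_extraAssignment_of_fst_ne (a : ∀ i, ∀ j : J i, K i j)
    {y : BellIndex (AddOutcome K i' j')} (hy : (y i').1 ≠ j') :
    bellDet (extraAssignment i' j' a) y = bellDet (keepAssignment i' j' a) y := by
  unfold bellDet
  congr 1
  refine propext (forall_congr' fun i => ?_)
  rw [extraAssignment_of_ne, keepAssignment]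
  intro h
  rw [Sigma.ext_iff] at h
  obtain ⟨h1, h2⟩ := h
  dsimp only at h1
  subst h1
  exact hy (eq_of_heq h2)

open Classical in
/-- The linear map that extends a vector by zero on the components involving the extra outcome. -/
noncomputable def keepMap (kstar : K i' j') :
    (BellIndex K → ℝ) →ₗ[ℝ] (BellIndex (AddOutcome K i' j') → ℝ) where
  toFun p y := if y i' = ⟨j', extraOutcome K i' j'⟩ then 0 else p (mergeIndex kstar y)
  map_add' p q := by
    funext y
    simp only [Pi.add_apply]
    split_ifs <;> ring
  map_smul' r p := by
    funext y
    simp only [Pi.smul_apply, smul_eq_mul, RingHom.id_apply]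
    split_ifs <;> ring

theorem keepMap_bellDet (kstar : K i' j') (a : ∀ i, ∀ j : J i, K i j) :
    keepMap kstar (bellDet a) = bellDet (keepAssignment i' j' a) := by
  funext y
  simp only [keepMap, LinearMap.coe_mk, AddHom.coe_mk]
  split_ifs with hy
  · refine (if_neg fun hall => ?_).symm
    have h := hall i'
    rw [hy] at h
    cases h
  · exact (bellDet_keepAssignment_of_ne kstar a hy).symm

end Outcome

/-! ### Merging the extra outcome, and moving weight to it -/

section Maps

variable {ι : Type*} [DecidableEq ι] {J : ι → Type*} {K : ∀ i, J i → Type*}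

/-- The index of the enlarged scenario in which party `i'` obtains the extra outcome. -/
def extraIndex (i' : ι) (j' : J i') (x : BellIndex K) : BellIndex (AddOutcome K i' j') :=
  Function.update (fun i => keepOutcome i' j' (x i)) i' ⟨j', extraOutcome K i' j'⟩

theorem extraIndex_self (i' : ι) (j' : J i') (x : BellIndex K) :
    extraIndex i' j' x i' = ⟨j', extraOutcome K i' j'⟩ :=
  Function.update_self ..

theorem extraIndex_of_ne (i' : ι) (j' : J i') (x : BellIndex K) {i : ι} (h : i ≠ i') :
    extraIndex i' j' x i = keepOutcome i' j' (x i) :=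
  Function.update_of_ne h ..

open Classical in
/-- The linear map that merges the extra outcome into `kstar`. -/
noncomputable def mergeMap {i' : ι} {j' : J i'} (kstar : K i' j') :
    (BellIndex (AddOutcome K i' j') → ℝ) →ₗ[ℝ] (BellIndex K → ℝ) where
  toFun p x := p (fun i => keepOutcome i' j' (x i)) +
    if x i' = ⟨j', kstar⟩ then p (extraIndex i' j' x) else 0
  map_add' p q := by
    funext x
    simp only [Pi.add_apply]
    split_ifs <;> ring
  map_smul' r p := by
    funext x
    simp only [Pi.smul_apply, smul_eq_mul, RingHom.id_apply]
    split_ifs <;> ring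

open Classical in
/-- The linear map that moves weights of the other parties' components from `kstar` to the extra
outcome. -/
noncomputable def moveMap {i' : ι} {j' : J i'} (kstar : K i' j') :
    (BellOthers K i' → ℝ) →ₗ[ℝ] (BellIndex (AddOutcome K i' j') → ℝ) where
  toFun w y := (if y i' = ⟨j', extraOutcome K i' j'⟩ then 1 else
    if y i' = ⟨j', Sum.inl kstar⟩ then -1 else 0) * w fun l => mergeIndex kstar y l
  map_add' p q := by
    funext y
    simp only [Pi.add_apply]
    ring
  map_smul' r p := by
    funext y
    simp only [Pi.smul_apply, smul_eq_mul, RingHom.id_apply]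
    ring

/-- `bellRestrict` as a linear map. -/
def bellRestrictMap (i : ι) (j : J i) (k : K i j) :
    (BellIndex K → ℝ) →ₗ[ℝ] (BellOthers K i → ℝ) where
  toFun p := bellRestrict p i j k
  map_add' _ _ := rfl
  map_smul' _ _ := rfl

theorem bellRestrict_apply_of_eq (p : BellIndex K → ℝ) {i : ι} {j : J i} {k : K i j}
    {x : BellIndex K} (hx : x i = ⟨j, k⟩) : bellRestrict p i j k (fun l => x l) = p x := by
  unfold bellRestrict
  rw [← hx]
  exact congrArg p ((Equiv.piSplitAt i fun l => Σ j : J l, K l j).symm_apply_apply x)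

theorem bellRestrict_bellDet_of_ne {a : ∀ i, ∀ j : J i, K i j} {i : ι} {j : J i} {k : K i j}
    (h : a i j ≠ k) : bellRestrict (bellDet a) i j k = 0 := by
  funext x
  simp only [bellRestrict, bellDet, Pi.zero_apply, ite_eq_right_iff, one_ne_zero, imp_false]
  intro hall
  have h1 := hall i
  have hx : (Equiv.piSplitAt i fun l => Σ j : J l, K l j).symm (⟨j, k⟩, x) i = ⟨j, k⟩ :=
    dif_pos rfl
  rw [hx] at h1
  exact h h1

variable {i' : ι} {j' : J i'}

theorem mergeMap_bellDet_keepAssignment (kstar : K i' j') (a : ∀ i, ∀ j : J i, K i j) :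
    mergeMap kstar (bellDet (keepAssignment i' j' a)) = bellDet a := by
  funext x
  have h1 : bellDet (keepAssignment i' j' a) (extraIndex i' j' x) = 0 := by
    refine if_neg fun hall => ?_
    have h := hall i'
    rw [extraIndex_self] at h
    cases h
  simp only [mergeMap, LinearMap.coe_mk, AddHom.coe_mk, h1, ite_self, add_zero]
  exact bellDet_keepAssignment_keepOutcome i' j' a x

theorem mergeIndex_extraIndex (kstar : K i' j') {x : BellIndex K} (hx : x i' = ⟨j', kstar⟩) :
    mergeIndex kstar (extraIndex i' j' x) = x := by
  funext i
  by_cases h : i = i'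
  · subst h
    simp only [mergeIndex]
    rw [extraIndex_self, hx]
    rfl
  · simp only [mergeIndex]
    rw [extraIndex_of_ne _ _ _ h]
    rfl

/-- At components involving the extra outcome, `extraAssignment` behaves as the original assignment
at the merged components. -/
theorem bellDet_extraAssignment_of_eq {kstar : K i' j'} {a : ∀ i, ∀ j : J i, K i j}
    (ha : a i' j' = kstar) {y : BellIndex (AddOutcome K i' j')}
    (hy : y i' = ⟨j', extraOutcome K i' j'⟩) :
    bellDet (extraAssignment i' j' a) y = bellDet a (mergeIndex kstar y) := by
  unfold bellDet
  congr 1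
  refine propext (forall_congr' fun i => ?_)
  by_cases h : i = i'
  · subst h
    simp only [mergeIndex]
    rw [hy]
    simp [extraAssignment_self, ha, extraOutcome, mergeOutcome]
  · have hne : ∀ j : J i, (⟨i, j⟩ : Σ i, J i) ≠ ⟨i', j'⟩ := fun j hj => h (congrArg Sigma.fst hj)
    rw [extraAssignment_of_ne a (hne _)]
    simp only [mergeIndex]
    rcases y i with ⟨j, k | e⟩
    · simp [mergeOutcome]
    · exact absurd e.down (hne j)

theorem mergeMap_bellDet_extraAssignment {kstar : K i' j'} {a : ∀ i, ∀ j : J i, K i j}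
    (ha : a i' j' = kstar) :
    mergeMap kstar (bellDet (extraAssignment i' j' a)) = bellDet a := by
  funext x
  simp only [mergeMap, LinearMap.coe_mk, AddHom.coe_mk]
  split_ifs with hx
  · rw [bellDet_extraAssignment_keep (k := kstar) (by rw [hx]; rfl),
      bellDet_extraAssignment_of_eq ha (extraIndex_self i' j' x), mergeIndex_extraIndex kstar hx,
      zero_add]
  · rw [add_zero]
    by_cases hj : (x i').1 = j'
    · rcases hxi : x i' with ⟨j, k⟩
      rw [hxi] at hj
      dsimp only at hj
      subst hj
      rw [bellDet_extraAssignment_keep (k := k) (by rw [hxi]; rfl)]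
      refine (if_neg fun hall => hx ?_).symm
      have h := hall i'
      rw [hxi] at h
      dsimp only at h
      rw [hxi, ← h, ha]
    · rw [bellDet_extraAssignment_of_fst_ne a hj]
      exact bellDet_keepAssignment_keepOutcome i' j' a x

/-- The two vertices differ only where party `i'` measures `j'` and obtains `k'` or `k⋆`. There the
difference is plus or minus the restriction of `p^a`, so it depends on `a` only through that
restriction. -/
theorem moveMap_bellRestrict_bellDet {kstar : K i' j'} {a : ∀ i, ∀ j : J i, K i j}
    (ha : a i' j' = kstar) :
    moveMap kstar (bellRestrict (bellDet a) i' j' kstar) =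
      bellDet (extraAssignment i' j' a) - bellDet (keepAssignment i' j' a) := by
  rw [← keepMap_bellDet kstar]
  funext y
  simp only [moveMap, keepMap, LinearMap.coe_mk, AddHom.coe_mk, Pi.sub_apply]
  split_ifs with hy hy'
  · rw [bellRestrict_apply_of_eq, bellDet_extraAssignment_of_eq ha hy, one_mul, sub_zero]
    simp only [mergeIndex]
    rw [hy]
    rfl
  · rw [bellRestrict_apply_of_eq, bellDet_extraAssignment_keep hy', neg_one_mul, zero_sub]
    simp only [mergeIndex]
    rw [hy']
    rfl
  -- Elsewhere both vertices vanish (measurement `j'`, a third outcome) or agree (another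
  -- measurement).
  · rw [zero_mul, eq_comm, sub_eq_zero]
    by_cases hj : (y i').1 = j'
    · rcases hyi : y i' with ⟨j, k | e⟩
      · rw [hyi] at hj
        dsimp only at hj
        subst hj
        rw [bellDet_extraAssignment_keep hyi]
        refine (if_neg fun hall => hy' ?_).symm
        have h := hall i'
        simp only [mergeIndex] at h
        rw [hyi] at h
        simp only [mergeOutcome] at h
        rw [hyi, ← h, ha]
      · cases e.down
        exact absurd hyi hy
    · rw [bellDet_extraAssignment_of_fst_ne a hj, bellDet_keepAssignment_of_ne kstar a hy]

/-- Merging sends vertices to vertices, and the kept assignments already reach all of them. -/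
theorem mergeMap_image_bellPolytope (kstar : K i' j') :
    mergeMap kstar '' bellPolytope (AddOutcome K i' j') = bellPolytope K := by
  unfold bellPolytope
  rw [LinearMap.image_convexHull]
  congr 1
  ext p
  constructor
  · rintro ⟨_, ⟨a', rfl⟩, rfl⟩
    obtain ⟨a, rfl | ⟨ha, rfl⟩⟩ := exists_eq_keepAssignment_or_extraAssignment kstar a'
    · exact ⟨a, (mergeMap_bellDet_keepAssignment kstar a).symm⟩
    · exact ⟨a, (mergeMap_bellDet_extraAssignment ha).symm⟩
  · rintro ⟨a, rfl⟩
    exact ⟨_, ⟨keepAssignment i' j' a, rfl⟩, mergeMap_bellDet_keepAssignment kstar a⟩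

theorem liftedLHS_eq_dotProduct_mergeMap [Fintype ι] [∀ i, Fintype (J i)]
    [∀ i j, Fintype (K i j)] (kstar : K i' j') (b : BellIndex K → ℝ)
    (p : BellIndex (AddOutcome K i' j') → ℝ) :
    liftedLHS i' j' kstar b p = b ⬝ᵥ mergeMap kstar p := by
  classical
  have h : mergeMap kstar p = (fun x => p fun i => keepOutcome i' j' (x i)) +
      fun x => if x i' = ⟨j', kstar⟩ then p (extraIndex i' j' x) else 0 := by
    funext x
    simp only [mergeMap, LinearMap.coe_mk, AddHom.coe_mk, Pi.add_apply]
  rw [h, dotProduct_add, liftedLHS]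
  congr 1
  simp only [dotProduct]
  -- With the index of party `i'` split off, only its value `(j', k⋆)` contributes.
  rw [← (Equiv.piSplitAt i' fun l => Σ j : J l, K l j).symm.sum_comp, Fintype.sum_prod_type,
    Finset.sum_eq_single (⟨j', kstar⟩ : Σ j : J i', K i' j)]
  · refine Finset.sum_congr rfl fun x _ => ?_
    rw [if_pos (by simp)]
    simp only [bellRestrict]
    congr 2
    funext l
    by_cases hl : l = i'
    · subst hl
      simp [extraIndex]
    · simp [extraIndex, hl]
  · intro z _ hz
    refine Finset.sum_eq_zero fun x _ => ?_
    rw [if_neg (by simpa using hz), mul_zero]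
  · simp

end Maps

/-! ### The lifted facet -/

theorem theorem4 {ι : Type*} [Fintype ι] [DecidableEq ι] {J : ι → Type*} [∀ i, Fintype (J i)]
    {K : ∀ i, J i → Type*} [∀ i j, Fintype (K i j)]
    (i' : ι) (j' : J i') (kstar : K i' j') (b : BellIndex K → ℝ) (b₀ : ℝ)
    (hgen : GenuinelyPartite b b₀)
    (hfacet : SupportsFacet (bellPolytope K) (fun p => b ⬝ᵥ p) b₀) :
    SupportsFacet (bellPolytope (AddOutcome K i' j')) (liftedLHS i' j' kstar b) b₀ := by
  classical
  rw [show liftedLHS i' j' kstar b = fun p => b ⬝ᵥ mergeMap kstar p from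
    funext (liftedLHS_eq_dotProduct_mergeMap kstar b)]
  refine hfacet.comp_of_image (mergeMap kstar) (mergeMap_image_bellPolytope kstar) ?_
  set F' := {p ∈ bellPolytope (AddOutcome K i' j') | b ⬝ᵥ mergeMap kstar p = b₀}
  have hdet : ∀ a : ∀ i, ∀ j : J i, K i j, bellDet a ∈ bellPolytope K :=
    fun a => subset_convexHull ℝ _ ⟨a, rfl⟩
  -- moving weight from `kstar` to the extra outcome is a direction of the lifted face
  have hmove : ∀ a : ∀ i, ∀ j : J i, K i j, a i' j' = kstar →
      moveMap kstar (bellRestrict (bellDet a) i' j' kstar) ∈ vectorSpan ℝ F' := by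
    intro a₀ ha₀
    by_contra hnot
    obtain ⟨φ, hφ, hφ0⟩ := Submodule.exists_le_ker_of_notMem hnot
    set ψ : (BellOthers K i' → ℝ) →ₗ[ℝ] ℝ := φ ∘ₗ moveMap kstar
    let f : (BellIndex K → ℝ) →ₗ[ℝ] ℝ := dotProductBilin ℝ ℝ b
    have hvan : ∀ p ∈ bellPolytope K, f p = b₀ →
        (ψ ∘ₗ bellRestrictMap i' j' kstar) p = 0 := by
      refine fun p hp hpc => eq_zero_of_mem_convexHull_face (f := f) (c := b₀)
        (fun q hq => hfacet.1 q (subset_convexHull ℝ _ hq)) ?_ hp hpc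
      rintro _ ⟨a, rfl⟩ hac
      by_cases ha : a i' j' = kstar
      · refine hφ0 ?_
        change moveMap kstar (bellRestrict (bellDet a) i' j' kstar) ∈ _
        rw [moveMap_bellRestrict_bellDet ha]
        refine vsub_mem_vectorSpan ℝ ⟨subset_convexHull ℝ _ ⟨_, rfl⟩, ?_⟩
          ⟨subset_convexHull ℝ _ ⟨_, rfl⟩, ?_⟩
        · rw [mergeMap_bellDet_extraAssignment ha]
          exact hac
        · rw [mergeMap_bellDet_keepAssignment]
          exact hac
      · change ψ (bellRestrict (bellDet a) i' j' kstar) = 0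
        rw [bellRestrict_bellDet_of_ne ha, map_zero]
    obtain ⟨μ, hμ⟩ := SupportsFacet.exists_eq_mul (f := f) hfacet _ hvan
    -- Otherwise `φ` would vanish on the direction coming from `a₀`, which it separates.
    have hμ0 : μ ≠ 0 := by
      rintro rfl
      refine hφ ?_
      have h := hμ _ (hdet a₀)
      rwa [zero_mul] at h
    -- The coefficients are those of `μ⁻¹ • ψ` in the standard basis.
    refine hgen ⟨i', j', kstar, fun x => μ⁻¹ * ψ fun y => if x = y then 1 else 0, fun p hp => ?_⟩
    have h := hμ p hp
    change ψ (bellRestrict p i' j' kstar) = μ * (b ⬝ᵥ p - b₀) at h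
    rw [LinearMap.pi_apply_eq_sum_univ] at h
    rw [← inv_mul_cancel_left₀ hμ0 (b ⬝ᵥ p - b₀), ← h, Finset.mul_sum]
    refine Finset.sum_congr rfl fun x _ => ?_
    rw [smul_eq_mul]
    ring
  intro v hv hv0
  -- `T` fixes the kernel of `mergeMap`, kills the vertices that avoid `k'`, and turns the others
  -- into the directions of `hmove`. A collapsed direction `v = T v` is thus a combination of those.
  let T : (BellIndex (AddOutcome K i' j') → ℝ) →ₗ[ℝ] (BellIndex (AddOutcome K i' j') → ℝ) :=
    LinearMap.id - keepMap kstar ∘ₗ mergeMap kstar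
  have hTapply : ∀ p, T p = p - keepMap kstar (mergeMap kstar p) := fun _ => rfl
  have hv' : v = T v := by
    rw [hTapply, hv0, map_zero, sub_zero]
  rw [bellPolytope, ← direction_affineSpan, affineSpan_convexHull, direction_affineSpan] at hv
  have hle : vectorSpan ℝ (Set.range (bellDet (K := AddOutcome K i' j'))) ≤
      (vectorSpan ℝ F').comap T := by
    have hgenr : ∀ a' : ∀ i, ∀ j : J i, AddOutcome K i' j' i j,
        T (bellDet a') ∈ vectorSpan ℝ F' := by
      intro a'
      obtain ⟨a, rfl | ⟨ha, rfl⟩⟩ := exists_eq_keepAssignment_or_extraAssignment kstar a'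
      · rw [hTapply, mergeMap_bellDet_keepAssignment, keepMap_bellDet, sub_self]
        exact Submodule.zero_mem _
      · have h := hmove a ha
        rwa [moveMap_bellRestrict_bellDet ha, ← keepMap_bellDet kstar,
          ← mergeMap_bellDet_extraAssignment ha, ← hTapply] at h
    rw [vectorSpan_def, Submodule.span_le]
    rintro _ ⟨_, ⟨a, rfl⟩, _, ⟨a₁, rfl⟩, rfl⟩
    simp only [vsub_eq_sub, SetLike.mem_coe, Submodule.mem_comap, map_sub]
    exact Submodule.sub_mem _ (hgenr a) (hgenr a₁)
  rw [hv']
  exact hle hv
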